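/- Let $h,f\in C^2((0,\infty),\mathbb{R})$ with $h(t)=h(1/t)$ for all $t>0$, put $g(x,y)=h(x/y)+f(xy)$ for $x,y>0$, and let $W:\mathrm{GL}^+(2)\to\mathbb{R}$ be given by $$W(F)=g(\lambda_1,\lambda_2)=h\Big(\frac{\lambda_1}{\lambda_2}\Big)+f(\lambda_1\lambda_2),$$ where $\lambda_1,\lambda_2>0$ are the singular values of $F\in\mathrm{GL}^+(2)=\{F\in\mathbb{R}^{2\times2}:\det F>0\}$. Call $W$ rank-one convex if for all $F\in \mathrm{GL}^+(2)$ and $\xi,\eta\in\mathbb{R}^2$ the map $s\mapsto W(F+s\,\xi\otimes\eta)$ is convex on the interval $\{s\in\mathbb{R}:\det(F+s\,\xi\otimes\eta)>0\}$. Set $$a(t)=t^2(t^2-1)h'(t)h''(t)-2t\,h'(t)^2,\quad b(t)=(t^2+3)h'(t)+2t(t^2+1)h''(t),\quad c(t)=4t\,(h'(t)+t\,h''(t)).$$ Then $W$ is rank-one convex if and only if the following four conditions hold: - A) $t^2h''(t)+z^2f''(z)\ge 0$ for all $t,z\in(0,\infty)$; - B) $h'(t)\ge 0$ for all $t\ge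 1$; - C) for all $t,z\in(0,\infty)$ with $t\ne 1$: $\ \frac{2t}{t-1}h'(t)-t^2h''(t)+z^2f''(z)\ge 0$ or $a(t)+[b(t)-c(t)]\,z^2f''(z)\ge 0$; - D) for all $t,z\in(0,\infty)$: $\ \frac{2t}{t+1}h'(t)+t^2h''(t)-z^2f''(z)\ge 0$ or $a(t)+[b(t)+c(t)]\,z^2f''(z)\ge 0$. Moreover A), B), C), D) are equivalent, respectively, to the conditions i), ii), iv), v) in the following list of Knowles–Sternberg conditions for $g$, and B) implies iii): - i) $g_{xx}\ge0$ and $g_{yy}\ge0$ for all $x,y>0$; - ii) $\frac{x g_x-y g_y}{x-y}\ge 0$ for all $x,y>0$, $x\neq y$; - iii) $g_{xx}-g_{xy}+\frac{g_x}{x}\ge0$ and $g_{yy}-g_{xy}+\frac{g_y}{y}\ge0$ for all $x=y>0$; - iv) $\sqrt{g_{xx}g_{yy}}+g_{xy}+\frac{g_x-g_y}{x-y}\ge0$ for all $x,y>0$, $x\ne y$; - v) $\sqrt{g_{xx}g_{yy}}-g_{xy}+\frac{g_x+g_y}{x+y}\ge0$ for all $x,y>0$. (In iv) and v) the square root of a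 negative number, which cannot occur when i) holds, is read as $0$.) -/

import Mathlib

noncomputable section

namespace PlanarElasticity

/-- The larger of the two singular values of a real `2 × 2` matrix `F`
(regarded as an operator on the Euclidean plane). -/
def sigma1 (F : Matrix (Fin 2) (Fin 2) ℝ) : ℝ :=
  (Matrix.toEuclideanLin F).singularValues 0

/-- The smaller of the two singular values of a real `2 × 2` matrix `F`. -/
def sigma2 (F : Matrix (Fin 2) (Fin 2) ℝ) : ℝ :=
  (Matrix.toEuclideanLin F).singularValues 1

/-- Rank-one convexity on `GL⁺(2) = {F | 0 < det F}`: for every `F ∈ GL⁺(2)` and all `ξ, η ∈ ℝ²`,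
the map `s ↦ W (F + s ξ ⊗ η)` is convex on the set of those `s` with `F + s ξ ⊗ η ∈ GL⁺(2)`.
As `s ↦ det (F + s ξ ⊗ η)` is affine, this set is an interval. Only the values of `W` on `GL⁺(2)`
matter. -/
def RankOneConvexGLPos (W : Matrix (Fin 2) (Fin 2) ℝ → ℝ) : Prop :=
  ∀ F : Matrix (Fin 2) (Fin 2) ℝ, 0 < F.det → ∀ ξ η : Fin 2 → ℝ,
    ConvexOn ℝ {s : ℝ | 0 < (F + s • Matrix.vecMulVec ξ η).det}
      (fun s : ℝ => W (F + s • Matrix.vecMulVec ξ η))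

/-! ### Partial derivatives of a function `g (x, y)` -/

/-- `∂g/∂x`. -/
def dx (g : ℝ → ℝ → ℝ) (x y : ℝ) : ℝ := deriv (fun s => g s y) x

/-- `∂g/∂y`. -/
def dy (g : ℝ → ℝ → ℝ) (x y : ℝ) : ℝ := deriv (fun s => g x s) y

/-- `∂²g/∂x²`. -/
def dxx (g : ℝ → ℝ → ℝ) : ℝ → ℝ → ℝ := dx (dx g)

/-- `∂²g/∂x∂y`. -/
def dxy (g : ℝ → ℝ → ℝ) : ℝ → ℝ → ℝ := dx (dy g)

/-- `∂²g/∂y²`. -/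
def dyy (g : ℝ → ℝ → ℝ) : ℝ → ℝ → ℝ := dy (dy g)

/-! ### The five Knowles–Sternberg conditions for `g : (0,∞)² → ℝ` -/

def KnowlesSternbergI (g : ℝ → ℝ → ℝ) : Prop :=
  ∀ x y : ℝ, 0 < x → 0 < y → 0 ≤ dxx g x y ∧ 0 ≤ dyy g x y

def KnowlesSternbergII (g : ℝ → ℝ → ℝ) : Prop :=
  ∀ x y : ℝ, 0 < x → 0 < y → x ≠ y → 0 ≤ (x * dx g x y - y * dy g x y) / (x - y)

def KnowlesSternbergIII (g : ℝ → ℝ → ℝ) : Prop :=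
  ∀ x y : ℝ, 0 < x → 0 < y → x = y →
    0 ≤ dxx g x y - dxy g x y + dx g x y / x ∧ 0 ≤ dyy g x y - dxy g x y + dy g x y / y

def KnowlesSternbergIV (g : ℝ → ℝ → ℝ) : Prop :=
  ∀ x y : ℝ, 0 < x → 0 < y → x ≠ y →
    0 ≤ √(dxx g x y * dyy g x y) + dxy g x y + (dx g x y - dy g x y) / (x - y)

def KnowlesSternbergV (g : ℝ → ℝ → ℝ) : Prop :=
  ∀ x y : ℝ, 0 < x → 0 < y →
    0 ≤ √(dxx g x y * dyy g x y) - dxy g x y + (dx g x y + dy g x y) / (x + y)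

/-! ### The conditions A)–D) in the variables `t = λ₁ / λ₂` and `z = λ₁ λ₂` -/

/-- `a(t) = t² (t² - 1) h'(t) h''(t) - 2 t h'(t)²`. -/
def coeffA (h : ℝ → ℝ) (t : ℝ) : ℝ :=
  t ^ 2 * (t ^ 2 - 1) * deriv h t * deriv (deriv h) t - 2 * t * deriv h t ^ 2

/-- `b(t) = (t² + 3) h'(t) + 2 t (t² + 1) h''(t)`. -/
def coeffB (h : ℝ → ℝ) (t : ℝ) : ℝ :=
  (t ^ 2 + 3) * deriv h t + 2 * t * (t ^ 2 + 1) * deriv (deriv h) t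

/-- `c(t) = 4 t (h'(t) + t h''(t))`. -/
def coeffC (h : ℝ → ℝ) (t : ℝ) : ℝ :=
  4 * t * (deriv h t + t * deriv (deriv h) t)

def ConditionA (h f : ℝ → ℝ) : Prop :=
  ∀ t z : ℝ, 0 < t → 0 < z → 0 ≤ t ^ 2 * deriv (deriv h) t + z ^ 2 * deriv (deriv f) z

def ConditionB (h : ℝ → ℝ) : Prop :=
  ∀ t : ℝ, 1 ≤ t → 0 ≤ deriv h t

def ConditionC (h f : ℝ → ℝ) : Prop :=
  ∀ t z : ℝ, 0 < t → 0 < z → t ≠ 1 →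
    0 ≤ 2 * t / (t - 1) * deriv h t - t ^ 2 * deriv (deriv h) t + z ^ 2 * deriv (deriv f) z ∨
    0 ≤ coeffA h t + (coeffB h t - coeffC h t) * (z ^ 2 * deriv (deriv f) z)

def ConditionD (h f : ℝ → ℝ) : Prop :=
  ∀ t z : ℝ, 0 < t → 0 < z →
    0 ≤ 2 * t / (t + 1) * deriv h t + t ^ 2 * deriv (deriv h) t - z ^ 2 * deriv (deriv f) z ∨
    0 ≤ coeffA h t + (coeffB h t + coeffC h t) * (z ^ 2 * deriv (deriv f) z)

/-- `g(x, y) = h(x / y) + f(x y)`, the energy as a function of the two singular values. -/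
def volIso (h f : ℝ → ℝ) (x y : ℝ) : ℝ := h (x / y) + f (x * y)

end PlanarElasticity

end

/-! Split a planar matrix into its conformal and anticonformal parts, two complex numbers p and q.
Then det F = |p|² - |q|², and for det F > 0 the singular values are |p| ± |q|. Since det (ξ ⊗ η) =
0, along a rank-one line p and q run on straight lines with the same speed r = |ξ||η|/2. So N = P =
|p| and N = ρ = ±|q| both satisfy N N'' = r² - N'² and N'² ≤ r². As g is symmetric, the sign of ρ is
free; it serves to keep ρ smooth where q vanishes.

With x = P + ρ, y = P - ρ, t = x/y, z = xy, u = t²h''(t), v = t h'(t), w = z²f''(z), m = (P' + ρ')y,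
n = (P' - ρ')x, the second derivative of W times (xy)² is (u+w)m² + (u+2v+w)n² + 2mn(w-u-v) +
2vxy(Pρ'' - ρP'') (`sq_mul_energyDeriv₂`). Inserting the equations for ρ'' and P'' and splitting by
the sign of mn = xy(P'² - ρ'²) leaves a multiple of v(P/ρ - ρ/P), nonnegative by B), and a quadratic
form on a quadrant (`energy_form_nonneg`). Such a form with diagonal A, B ≥ 0 and off-diagonal entry
T is nonnegative for mn ≥ 0 iff √(AB) + T ≥ 0. A) at t and 1/t gives the diagonal; C) and D) are the
square-root inequalities for mn ≥ 0 and mn ≤ 0.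

Conversely, at diagonal matrices some directions move p or q radially, which removes the v-term and
leaves m, n arbitrary in a quadrant: this gives A), C), D). The direction e₁ ⊗ e₂ isolates the
v-term and gives B). -/

namespace PlanarElasticity

/-! ### Singular values from the conformal and anticonformal parts -/

/-- The modulus of the conformal part of a planar matrix. -/
noncomputable def confNorm (F : Matrix (Fin 2) (Fin 2) ℝ) : ℝ :=
  √(((F 0 0 + F 1 1) / 2) ^ 2 + ((F 1 0 - F 0 1) / 2) ^ 2)

/-- The modulus of the anticonformal part of a planar matrix. -/
noncomputable def antiNorm (F : Matrix (Fin 2) (Fin 2) ℝ) : ℝ :=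
  √(((F 0 0 - F 1 1) / 2) ^ 2 + ((F 1 0 + F 0 1) / 2) ^ 2)

lemma confNorm_sq (F : Matrix (Fin 2) (Fin 2) ℝ) :
    confNorm F ^ 2 = ((F 0 0 + F 1 1) / 2) ^ 2 + ((F 1 0 - F 0 1) / 2) ^ 2 :=
  Real.sq_sqrt (by positivity)

lemma antiNorm_sq (F : Matrix (Fin 2) (Fin 2) ℝ) :
    antiNorm F ^ 2 = ((F 0 0 - F 1 1) / 2) ^ 2 + ((F 1 0 + F 0 1) / 2) ^ 2 :=
  Real.sq_sqrt (by positivity)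

lemma sq_confNorm_sub_sq_antiNorm (F : Matrix (Fin 2) (Fin 2) ℝ) :
    confNorm F ^ 2 - antiNorm F ^ 2 = F.det := by
  rw [confNorm_sq, antiNorm_sq, Matrix.det_fin_two]; ring

lemma sigma_mul (F : Matrix (Fin 2) (Fin 2) ℝ) : sigma1 F * sigma2 F = |F.det| := by
  have h := LinearMap.normDet_eq_prod_singularValues (Matrix.toEuclideanLin F)
  rw [LinearMap.normDet_eq_norm_det, finrank_euclideanSpace_fin, Finset.prod_range_succ,
    Finset.prod_range_one] at h
  rw [sigma1, sigma2, ← h, Real.norm_eq_abs]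
  congr 1
  rw [Matrix.toEuclideanLin, Matrix.toLpLin_eq_toLin, LinearMap.det_toLin]

lemma sigma_sq_add_sq (F : Matrix (Fin 2) (Fin 2) ℝ) :
    sigma1 F ^ 2 + sigma2 F ^ 2 = F 0 0 ^ 2 + F 0 1 ^ 2 + F 1 0 ^ 2 + F 1 1 ^ 2 := by
  set T := Matrix.toEuclideanLin F with hT
  have hn : Module.finrank ℝ (EuclideanSpace ℝ (Fin 2)) = 2 := finrank_euclideanSpace_fin
  have htr := T.isSymmetric_adjoint_comp_self.trace_eq_sum_eigenvalues hn
  rw [Fin.sum_univ_two] at htr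
  have h0 := T.sq_singularValues_fin hn 0
  have h1 := T.sq_singularValues_fin hn 1
  have hcomp : LinearMap.adjoint T ∘ₗ T = Matrix.toEuclideanLin (F.conjTranspose * F) := by
    rw [hT, ← Matrix.toEuclideanLin_conjTranspose_eq_adjoint]
    simp only [Matrix.toEuclideanLin, Matrix.toLpLin_eq_toLin]
    rw [← Matrix.toLin_mul]
  have htr2 : LinearMap.trace ℝ _ (LinearMap.adjoint T ∘ₗ T) = (F.conjTranspose * F).trace := by
    rw [hcomp, Matrix.toEuclideanLin, Matrix.toLpLin_eq_toLin, Matrix.trace_toLin_eq]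
  rw [htr2, Matrix.trace_fin_two, Matrix.mul_apply, Matrix.mul_apply] at htr
  simp only [Fin.sum_univ_two, Matrix.conjTranspose_apply, star_trivial] at htr
  simp only [Fin.val_zero, Fin.val_one] at h0 h1
  simp only [sigma1, sigma2]
  rw [← hT, h0, h1]
  simp only [RCLike.ofReal_real_eq_id, id] at htr
  linarith

/-- Both (σ₁ ± σ₂)² and the squares of twice the moduli equal |F|² ± 2 det F, with |F| the Frobenius
norm. -/
lemma sigma_eq {F : Matrix (Fin 2) (Fin 2) ℝ} (hF : 0 < F.det) :
    sigma1 F = confNorm F + antiNorm F ∧ sigma2 F = confNorm F - antiNorm F := by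
  have hm := sigma_mul F
  have hs := sigma_sq_add_sq F
  rw [abs_of_pos hF, Matrix.det_fin_two] at hm
  have h1 : 0 ≤ sigma1 F := LinearMap.singularValues_nonneg _ _
  have h2 : 0 ≤ sigma2 F := LinearMap.singularValues_nonneg _ _
  have h12 : sigma2 F ≤ sigma1 F := LinearMap.singularValues_antitone _ zero_le_one
  have hp : confNorm F = (sigma1 F + sigma2 F) / 2 := by
    rw [confNorm, ← Real.sqrt_sq (by positivity : 0 ≤ (sigma1 F + sigma2 F) / 2)]
    congr 1; linarith
  have hq : antiNorm F = (sigma1 F - sigma2 F) / 2 := by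
    rw [antiNorm, ← Real.sqrt_sq (by linarith : 0 ≤ (sigma1 F - sigma2 F) / 2)]
    congr 1; linarith
  constructor <;> linarith

lemma antiNorm_lt_confNorm {F : Matrix (Fin 2) (Fin 2) ℝ} (hF : 0 < F.det) :
    antiNorm F < confNorm F := by
  have := sq_confNorm_sub_sq_antiNorm F
  exact lt_of_pow_lt_pow_left₀ 2 (Real.sqrt_nonneg _) (by linarith)

lemma abs_lt_confNorm {F : Matrix (Fin 2) (Fin 2) ℝ} (hF : 0 < F.det) {ρ : ℝ}
    (hρ : ρ ^ 2 = antiNorm F ^ 2) : |ρ| < confNorm F := by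
  have h0 : 0 ≤ antiNorm F := Real.sqrt_nonneg _
  rw [(sq_eq_sq_iff_abs_eq_abs _ _).mp hρ, abs_of_nonneg h0]
  exact antiNorm_lt_confNorm hF

lemma volIso_symm {h f : ℝ → ℝ} (hsymm : ∀ t : ℝ, 0 < t → h t = h (1 / t)) {x y : ℝ}
    (hx : 0 < x) (hy : 0 < y) : volIso h f x y = volIso h f y x := by
  rw [volIso, volIso, hsymm _ (div_pos hx hy), one_div_div, mul_comm]

/-- The energy may be computed with either sign of the anticonformal modulus. -/
lemma volIso_sigma_eq {h f : ℝ → ℝ} (hsymm : ∀ t : ℝ, 0 < t → h t = h (1 / t))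
    {F : Matrix (Fin 2) (Fin 2) ℝ} (hF : 0 < F.det) {ρ : ℝ} (hρ : ρ ^ 2 = antiNorm F ^ 2) :
    volIso h f (sigma1 F) (sigma2 F) = volIso h f (confNorm F + ρ) (confNorm F - ρ) := by
  obtain ⟨h1, h2⟩ := sigma_eq hF
  have h0 : 0 ≤ antiNorm F := Real.sqrt_nonneg _
  have hlt := antiNorm_lt_confNorm hF
  rw [h1, h2]
  rcases sq_eq_sq_iff_eq_or_eq_neg.mp hρ with rfl | rfl
  · rfl
  · rw [volIso_symm hsymm (by linarith) (by linarith), sub_neg_eq_add, sub_eq_add_neg]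

/-! ### Moduli along lines in the plane -/

/-- A signed modulus, along a line in the Euclidean plane traversed with speed `r`, with its first
and second derivatives. -/
structure IsModulus (S : Set ℝ) (r : ℝ) (ρ ρ₁ ρ₂ : ℝ → ℝ) : Prop where
  hasDerivAt : ∀ s ∈ S, HasDerivAt ρ (ρ₁ s) s
  hasDerivAt₁ : ∀ s ∈ S, HasDerivAt ρ₁ (ρ₂ s) s
  mul_eq : ∀ s ∈ S, ρ s * ρ₂ s = r ^ 2 - ρ₁ s ^ 2
  sq_le : ∀ s ∈ S, ρ₁ s ^ 2 ≤ r ^ 2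

lemma IsModulus.neg {S : Set ℝ} {r : ℝ} {ρ ρ₁ ρ₂ : ℝ → ℝ} (H : IsModulus S r ρ ρ₁ ρ₂) :
    IsModulus S r (fun s => -ρ s) (fun s => -ρ₁ s) (fun s => -ρ₂ s) where
  hasDerivAt s hs := (H.hasDerivAt s hs).neg
  hasDerivAt₁ s hs := (H.hasDerivAt₁ s hs).neg
  mul_eq s hs := by rw [neg_mul_neg, H.mul_eq s hs, neg_sq]
  sq_le s hs := by rw [neg_sq]; exact H.sq_le s hs

lemma isModulus_linear (S : Set ℝ) (r b : ℝ) :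
    IsModulus S r (fun s => b + s * r) (fun _ => r) (fun _ => 0) where
  hasDerivAt s _ := by simpa using ((hasDerivAt_id s).mul_const r).const_add b
  hasDerivAt₁ s _ := hasDerivAt_const s r
  mul_eq s _ := by simp
  sq_le s _ := le_rfl

lemma isModulus_sqrt {S : Set ℝ} {r a₀ a₁ b₀ b₁ : ℝ} (hr : r ^ 2 = a₁ ^ 2 + b₁ ^ 2)
    (hS : ∀ s ∈ S, 0 < √((a₀ + s * a₁) ^ 2 + (b₀ + s * b₁) ^ 2)) :
    IsModulus S r (fun s => √((a₀ + s * a₁) ^ 2 + (b₀ + s * b₁) ^ 2))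
      (fun s => ((a₀ + s * a₁) * a₁ + (b₀ + s * b₁) * b₁) /
        √((a₀ + s * a₁) ^ 2 + (b₀ + s * b₁) ^ 2))
      (fun s => (r ^ 2 - (((a₀ + s * a₁) * a₁ + (b₀ + s * b₁) * b₁) /
        √((a₀ + s * a₁) ^ 2 + (b₀ + s * b₁) ^ 2)) ^ 2) /
        √((a₀ + s * a₁) ^ 2 + (b₀ + s * b₁) ^ 2)) := by
  have ha (s : ℝ) : HasDerivAt (fun s => a₀ + s * a₁) a₁ s := by
    simpa using ((hasDerivAt_id s).mul_const a₁).const_add a₀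
  have hb (s : ℝ) : HasDerivAt (fun s => b₀ + s * b₁) b₁ s := by
    simpa using ((hasDerivAt_id s).mul_const b₁).const_add b₀
  have hd : ∀ s ∈ S, HasDerivAt (fun s => √((a₀ + s * a₁) ^ 2 + (b₀ + s * b₁) ^ 2))
      (((a₀ + s * a₁) * a₁ + (b₀ + s * b₁) * b₁) /
        √((a₀ + s * a₁) ^ 2 + (b₀ + s * b₁) ^ 2)) s := by
    intro s hs
    have hpos := Real.sqrt_pos.mp (hS s hs)
    have hpos' := (hS s hs).ne'
    refine ((((ha s).pow 2).add ((hb s).pow 2)).sqrt hpos.ne').congr_deriv ?_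
    change _ / (2 * √((a₀ + s * a₁) ^ 2 + (b₀ + s * b₁) ^ 2)) = _
    field_simp
    norm_num
  refine ⟨hd, fun s hs => ?_, fun s hs => ?_, fun s hs => ?_⟩
  · have hpos := hS s hs
    refine ((((ha s).mul_const a₁).add ((hb s).mul_const b₁)).div (hd s hs) hpos.ne').congr_deriv ?_
    simp only [Pi.add_apply]
    rw [hr]
    generalize √((a₀ + s * a₁) ^ 2 + (b₀ + s * b₁) ^ 2) = N at hpos ⊢
    field_simp
  · have hpos := hS s hs
    field_simp
  · have hpos := hS s hs
    have hsq := Real.sq_sqrt (Real.sqrt_pos.mp hpos).le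
    rw [div_pow, div_le_iff₀ (by positivity), hsq, hr]
    -- Cauchy–Schwarz; the defect is the squared cross product of position and velocity.
    nlinarith [sq_nonneg ((a₀ + s * a₁) * b₁ - (b₀ + s * b₁) * a₁)]

/-! ### Derivatives of h under t ↦ 1/t -/

lemma hasDerivAt_deriv_of_contDiffOn {h : ℝ → ℝ} (hh : ContDiffOn ℝ 2 h (Set.Ioi 0)) {t : ℝ}
    (ht : 0 < t) :
    HasDerivAt h (deriv h t) t ∧ HasDerivAt (deriv h) (deriv (deriv h) t) t := by
  have hn := Ioi_mem_nhds ht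
  refine ⟨((hh.differentiableOn (by norm_num)).differentiableAt hn).hasDerivAt, ?_⟩
  have h1 : ContDiffOn ℝ 1 (deriv h) (Set.Ioi 0) :=
    ((contDiffOn_succ_iff_deriv_of_isOpen (n := 1) isOpen_Ioi).mp (by rwa [one_add_one_eq_two])).2.2
  exact ((h1.differentiableOn (by norm_num)).differentiableAt hn).hasDerivAt

lemma deriv_inv {h : ℝ → ℝ} (hh : ContDiffOn ℝ 2 h (Set.Ioi 0))
    (hsymm : ∀ t : ℝ, 0 < t → h t = h (1 / t)) {t : ℝ} (ht : 0 < t) : deriv h (1 / t) = -t ^ 2 * deriv h t := by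
  have h1 := (hasDerivAt_deriv_of_contDiffOn hh (one_div_pos.mpr ht)).1
  have hi : HasDerivAt (fun t : ℝ => 1 / t) (-(t ^ 2)⁻¹) t := by
    simpa using hasDerivAt_inv ht.ne'
  have h2 := h1.comp t hi
  have h3 : h =ᶠ[nhds t] h ∘ fun t : ℝ => 1 / t := by
    filter_upwards [Ioi_mem_nhds ht] with s hs using hsymm s hs
  have h4 := (h2.congr_of_eventuallyEq h3).unique (hasDerivAt_deriv_of_contDiffOn hh ht).1
  rw [← h4]; field_simp

lemma deriv_deriv_inv {h : ℝ → ℝ} (hh : ContDiffOn ℝ 2 h (Set.Ioi 0))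
    (hsymm : ∀ t : ℝ, 0 < t → h t = h (1 / t)) {t : ℝ} (ht : 0 < t) :
    deriv (deriv h) (1 / t) = t ^ 4 * deriv (deriv h) t + 2 * t ^ 3 * deriv h t := by
  have h1 := (hasDerivAt_deriv_of_contDiffOn hh (one_div_pos.mpr ht)).2
  have hi : HasDerivAt (fun t : ℝ => 1 / t) (-(t ^ 2)⁻¹) t := by
    simpa using hasDerivAt_inv ht.ne'
  have h2 := h1.comp t hi
  have h3 : (deriv h ∘ fun t : ℝ => 1 / t) =ᶠ[nhds t] fun t => -t ^ 2 * deriv h t := by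
    filter_upwards [Ioi_mem_nhds ht] with s hs using deriv_inv hh hsymm hs
  have h4 := ((hasDerivAt_pow 2 t).neg).mul (hasDerivAt_deriv_of_contDiffOn hh ht).2
  have h5 := (h2.congr_of_eventuallyEq h3.symm).unique h4
  simp only [Pi.neg_apply] at h5
  generalize deriv (deriv h) (1 / t) = e at h5 ⊢
  field_simp at h5
  norm_num at h5
  linear_combination -h5

lemma deriv_one_eq_zero {h : ℝ → ℝ} (hh : ContDiffOn ℝ 2 h (Set.Ioi 0))
    (hsymm : ∀ t : ℝ, 0 < t → h t = h (1 / t)) : deriv h 1 = 0 := by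
  have := deriv_inv hh hsymm one_pos
  norm_num at this
  linarith

lemma ConditionB.mul_sub_nonneg {h : ℝ → ℝ} (hh : ContDiffOn ℝ 2 h (Set.Ioi 0))
    (hsymm : ∀ t : ℝ, 0 < t → h t = h (1 / t)) (hB : ConditionB h) {t : ℝ} (ht : 0 < t) :
    0 ≤ deriv h t * (t - 1) := by
  rcases le_or_gt 1 t with h1 | h1
  · exact mul_nonneg (hB t h1) (by linarith)
  · have := hB (1 / t) (by rw [le_div_iff₀ ht]; linarith)
    rw [deriv_inv hh hsymm ht] at this
    have h2 : deriv h t ≤ 0 := by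
      by_contra! h3
      nlinarith [mul_pos (pow_pos ht 2) h3]
    nlinarith

/-! ### Second derivative of the energy on a rank-one line, and its sign -/

/-- The first derivative of the energy along a path of principal stretches `P ± ρ`. -/
noncomputable def energyDeriv (h f : ℝ → ℝ) (P P₁ ρ ρ₁ : ℝ → ℝ) (s : ℝ) : ℝ :=
  deriv h ((P s + ρ s) / (P s - ρ s)) * (2 * (P s * ρ₁ s - ρ s * P₁ s) / (P s - ρ s) ^ 2) +
    deriv f ((P s + ρ s) * (P s - ρ s)) * (2 * (P s * P₁ s - ρ s * ρ₁ s))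

/-- The second derivative of the energy along a path of principal stretches `P ± ρ`. -/
noncomputable def energyDeriv₂ (h f : ℝ → ℝ) (P P₁ P₂ ρ ρ₁ ρ₂ : ℝ → ℝ) (s : ℝ) : ℝ :=
  deriv (deriv h) ((P s + ρ s) / (P s - ρ s)) *
      (2 * (P s * ρ₁ s - ρ s * P₁ s) / (P s - ρ s) ^ 2) ^ 2 +
    deriv h ((P s + ρ s) / (P s - ρ s)) * (2 * (P s * ρ₂ s - ρ s * P₂ s) / (P s - ρ s) ^ 2 -
      4 * (P₁ s - ρ₁ s) * (P s * ρ₁ s - ρ s * P₁ s) / (P s - ρ s) ^ 3) +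
    deriv (deriv f) ((P s + ρ s) * (P s - ρ s)) * (2 * (P s * P₁ s - ρ s * ρ₁ s)) ^ 2

lemma hasDerivAt_energy {h f : ℝ → ℝ} (hh : ContDiffOn ℝ 2 h (Set.Ioi 0))
    (hf : ContDiffOn ℝ 2 f (Set.Ioi 0)) {S : Set ℝ} {r : ℝ} {P P₁ P₂ ρ ρ₁ ρ₂ : ℝ → ℝ}
    (HP : IsModulus S r P P₁ P₂) (Hρ : IsModulus S r ρ ρ₁ ρ₂)
    (hlt : ∀ s ∈ S, |ρ s| < P s) {s : ℝ} (hs : s ∈ S) :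
    HasDerivAt (fun s => volIso h f (P s + ρ s) (P s - ρ s)) (energyDeriv h f P P₁ ρ ρ₁ s) s ∧
    HasDerivAt (energyDeriv h f P P₁ ρ ρ₁) (energyDeriv₂ h f P P₁ P₂ ρ ρ₁ ρ₂ s) s := by
  obtain ⟨hl1, hl2⟩ := abs_lt.mp (hlt s hs)
  have hx : 0 < P s + ρ s := by linarith
  have hy : 0 < P s - ρ s := by linarith
  have p0 := HP.hasDerivAt s hs
  have p1 := HP.hasDerivAt₁ s hs
  have q0 := Hρ.hasDerivAt s hs
  have q1 := Hρ.hasDerivAt₁ s hs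
  obtain ⟨h0, h1⟩ := hasDerivAt_deriv_of_contDiffOn hh (div_pos hx hy)
  obtain ⟨f0, f1⟩ := hasDerivAt_deriv_of_contDiffOn hf (mul_pos hx hy)
  have ht : HasDerivAt (fun s => (P s + ρ s) / (P s - ρ s))
      (2 * (P s * ρ₁ s - ρ s * P₁ s) / (P s - ρ s) ^ 2) s := by
    refine ((p0.add q0).div (p0.sub q0) hy.ne').congr_deriv ?_
    simp only [Pi.add_apply, Pi.sub_apply]
    ring
  have hz : HasDerivAt (fun s => (P s + ρ s) * (P s - ρ s))
      (2 * (P s * P₁ s - ρ s * ρ₁ s)) s := by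
    refine ((p0.add q0).mul (p0.sub q0)).congr_deriv ?_
    simp only [Pi.add_apply, Pi.sub_apply]
    ring
  have ht1 : HasDerivAt (fun s => 2 * (P s * ρ₁ s - ρ s * P₁ s) / (P s - ρ s) ^ 2)
      (2 * (P s * ρ₂ s - ρ s * P₂ s) / (P s - ρ s) ^ 2 -
      4 * (P₁ s - ρ₁ s) * (P s * ρ₁ s - ρ s * P₁ s) / (P s - ρ s) ^ 3) s := by
    refine ((((p0.mul q1).sub (q0.mul p1)).const_mul 2).div ((p0.sub q0).pow 2)
      (pow_ne_zero 2 hy.ne')).congr_deriv ?_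
    simp only [Pi.sub_apply, Pi.mul_apply, Pi.pow_apply]
    field_simp
    ring
  -- The two moduli have equal speed r, so P² - ρ² has zero second derivative.
  have hz1 : HasDerivAt (fun s => 2 * (P s * P₁ s - ρ s * ρ₁ s)) 0 s := by
    refine (((p0.mul p1).sub (q0.mul q1)).const_mul 2).congr_deriv ?_
    linear_combination 2 * HP.mul_eq s hs - 2 * Hρ.mul_eq s hs
  refine ⟨(h0.comp s ht).add (f0.comp s hz), ?_⟩
  refine (((h1.comp s ht).mul ht1).add ((f1.comp s hz).mul hz1)).congr_deriv ?_
  simp only [energyDeriv₂, Function.comp_apply]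
  ring

/-- The form is (√A m - √B n)² + 2mn(√(AB) + T). -/
lemma quadratic_nonneg {A B T m n : ℝ} (hA : 0 ≤ A) (hB : 0 ≤ B) (hT : 0 ≤ √(A * B) + T)
    (hmn : 0 ≤ m * n) : 0 ≤ A * m ^ 2 + B * n ^ 2 + 2 * (m * n) * T := by
  rw [Real.sqrt_mul hA] at hT
  nlinarith [Real.sq_sqrt hA, Real.sq_sqrt hB, sq_nonneg (√A * m - √B * n), mul_nonneg hmn hT]

lemma sqrt_add_nonneg_of_quadratic {A B T : ℝ} (hA : 0 ≤ A) (hB : 0 ≤ B)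
    (H : ∀ m n : ℝ, 0 ≤ m → 0 ≤ n → 0 ≤ A * m ^ 2 + B * n ^ 2 + 2 * (m * n) * T) :
    0 ≤ √(A * B) + T := by
  by_contra! hneg
  have hT : T < 0 := by linarith [Real.sqrt_nonneg (A * B)]
  rcases hA.eq_or_lt with rfl | hA'
  -- With A = 0 the form is linear in m; this m makes the cross term -(B + 1), which outweighs B.
  · have := H ((B + 1) / (-2 * T)) 1 (div_nonneg (by linarith) (by linarith)) zero_le_one
    have e : 2 * ((B + 1) / (-2 * T) * 1) * T = -(B + 1) := by field_simp [hT.ne]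
    rw [e] at this
    linarith
  rcases hB.eq_or_lt with rfl | hB'
  · have := H 1 ((A + 1) / (-2 * T)) zero_le_one (div_nonneg (by linarith) (by linarith))
    have e : 2 * (1 * ((A + 1) / (-2 * T))) * T = -(A + 1) := by field_simp [hT.ne]
    rw [e] at this
    linarith
  -- At this vector the form equals 2√(AB)(√(AB) + T).
  · have := H (√B) (√A) (Real.sqrt_nonneg _) (Real.sqrt_nonneg _)
    rw [Real.sqrt_mul hA] at hneg
    rw [Real.sq_sqrt hA, Real.sq_sqrt hB] at this
    have h1 := Real.sqrt_pos.mpr hA'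
    have h2 := Real.sqrt_pos.mpr hB'
    nlinarith [Real.sq_sqrt hA, Real.sq_sqrt hB, mul_pos h1 h2,
      mul_neg_of_pos_of_neg (mul_pos h1 h2) hneg]

/-- The normalized second derivative of the energy along a rank-one line. -/
lemma sq_mul_energyDeriv₂ {h f : ℝ → ℝ} {P P₁ P₂ ρ ρ₁ ρ₂ : ℝ → ℝ} {s : ℝ}
    (hlt : |ρ s| < P s) {x y t z u v w : ℝ} (hx : x = P s + ρ s) (hy : y = P s - ρ s)
    (ht : t = x / y) (hz : z = x * y) (hu : u = t ^ 2 * deriv (deriv h) t) (hv : v = t * deriv h t)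
    (hw : w = z ^ 2 * deriv (deriv f) z) :
    (x * y) ^ 2 * energyDeriv₂ h f P P₁ P₂ ρ ρ₁ ρ₂ s =
      (u + w) * ((P₁ s + ρ₁ s) * y) ^ 2 + (u + 2 * v + w) * ((P₁ s - ρ₁ s) * x) ^ 2 +
      2 * ((P₁ s + ρ₁ s) * y * ((P₁ s - ρ₁ s) * x)) * (w - u - v) +
      2 * v * (x * y) * (P s * ρ₂ s - ρ s * P₂ s) := by
  obtain ⟨hl1, hl2⟩ := abs_lt.mp hlt
  have hx0 : 0 < P s + ρ s := by linarith
  have hy0 : 0 < P s - ρ s := by linarith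
  have ht' : t = (P s + ρ s) / (P s - ρ s) := by rw [ht, hx, hy]
  have hz' : z = (P s + ρ s) * (P s - ρ s) := by rw [hz, hx, hy]
  rw [energyDeriv₂, ← ht', ← hz', hu, hv, hw, hx, hy]
  generalize deriv (deriv h) t = d2
  generalize deriv h t = d1
  generalize deriv (deriv f) z = e2
  rw [ht', hz']
  field_simp
  ring

/-- If d² ≤ c², split r² - d² = (r² - c²) + (c² - d²): the first part multiplies v(P/ρ - ρ/P) =
vxy/(ρP) ≥ 0, the second changes the off-diagonal entry to the one in C). If c² ≤ d², splitting r² -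
c² leads to D). The equation ρρ₂ = r² - d² does not determine ρ₂ at ρ = 0, hence `hρ0`. -/
lemma energy_form_nonneg {r P ρ c d P₂ ρ₂ x y u v w : ℝ} (hx : x = P + ρ) (hy : y = P - ρ)
    (hlt : |ρ| < P) (hP₂ : P * P₂ = r ^ 2 - c ^ 2) (hρ₂ : ρ * ρ₂ = r ^ 2 - d ^ 2)
    (hc : c ^ 2 ≤ r ^ 2) (hd : d ^ 2 ≤ r ^ 2) (hρ0 : ρ = 0 → ρ₂ = 0)
    (hA : 0 ≤ u + w) (hA' : 0 ≤ u + 2 * v + w) (hB : 0 ≤ v * ρ)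
    (hC : ρ ≠ 0 → 0 ≤ √((u + w) * (u + 2 * v + w)) + (v * y / ρ - u + w))
    (hD : 0 ≤ √((u + w) * (u + 2 * v + w)) + (v * y / P + u - w)) :
    0 ≤ (u + w) * ((c + d) * y) ^ 2 + (u + 2 * v + w) * ((c - d) * x) ^ 2 +
      2 * ((c + d) * y * ((c - d) * x)) * (w - u - v) +
      2 * v * (x * y) * (P * ρ₂ - ρ * P₂) := by
  obtain ⟨hl1, hl2⟩ := abs_lt.mp hlt
  have hP : 0 < P := (abs_nonneg _).trans_lt hlt
  have hx0 : 0 < x := by linarith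
  have hy0 : 0 < y := by linarith
  have hP₂' : P₂ = (r ^ 2 - c ^ 2) / P := by field_simp; linarith
  -- At ρ = 0 one has d² = r² ≥ c², so D) alone suffices.
  by_cases hρ : ρ = 0
  · subst hρ
    rw [hρ0 rfl, mul_zero, zero_mul, sub_zero, mul_zero, add_zero]
    have hdr : d ^ 2 = r ^ 2 := by linarith
    have := quadratic_nonneg (m := (c + d) * y) (n := -((c - d) * x)) hA hA' hD
      (by nlinarith [mul_pos hx0 hy0])
    refine this.trans_eq ?_
    have : v * y / P = v := by rw [hy]; field_simp; ring
    rw [this]; ring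
  have hρ₂' : ρ₂ = (r ^ 2 - d ^ 2) / ρ := by field_simp; linarith
  have hvρ : 0 ≤ v / ρ := by
    have : v / ρ = v * ρ / ρ ^ 2 := by field_simp
    rw [this]; positivity
  have hgap : 0 ≤ v * (P / ρ - ρ / P) := by
    have : v * (P / ρ - ρ / P) = v / ρ * ((x * y) / P) := by rw [hx, hy]; field_simp; ring
    rw [this]; positivity
  rcases le_total (d ^ 2) (c ^ 2) with hcd | hcd
  · have h1 := quadratic_nonneg (m := (c + d) * y) (n := (c - d) * x) hA hA' (hC hρ)
      (by nlinarith [mul_pos hx0 hy0])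
    have h2 : 0 ≤ 2 * (x * y) * (r ^ 2 - c ^ 2) * (v * (P / ρ - ρ / P)) :=
      mul_nonneg (mul_nonneg (by positivity) (by linarith)) hgap
    refine (add_nonneg h1 h2).trans_eq ?_
    rw [hP₂', hρ₂', hx, hy]; field_simp; ring
  · have h1 := quadratic_nonneg (m := (c + d) * y) (n := -((c - d) * x)) hA hA' hD
      (by nlinarith [mul_pos hx0 hy0])
    have h2 : 0 ≤ 2 * (x * y) * (r ^ 2 - d ^ 2) * (v * (P / ρ - ρ / P)) :=
      mul_nonneg (mul_nonneg (by positivity) (by linarith)) hgap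
    refine (add_nonneg h1 h2).trans_eq ?_
    rw [hP₂', hρ₂', hx, hy]; field_simp; ring

/-- A convex function has nonnegative second derivative. -/
lemma _root_.ConvexOn.second_deriv_nonneg {S U : Set ℝ} {φ φ₁ : ℝ → ℝ} {φ₂ a : ℝ}
    (hφ : ConvexOn ℝ S φ) (hU : IsOpen U) (hUS : U ⊆ S) (ha : a ∈ U)
    (h1 : ∀ s ∈ U, HasDerivAt φ (φ₁ s) s) (h2 : HasDerivAt φ₁ φ₂ a) : 0 ≤ φ₂ := by
  obtain ⟨ε, hε, hball⟩ := Metric.isOpen_iff.mp hU a ha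
  have hc := hφ.subset (hball.trans hUS) (convex_ball a ε)
  have hm := hc.monotoneOn_derivWithin
    fun s hs => (h1 s (hball hs)).differentiableAt.differentiableWithinAt
  have hm' : MonotoneOn φ₁ (Metric.ball a ε) := by
    refine hm.congr fun s hs => ?_
    exact (h1 s (hball hs)).hasDerivWithinAt.derivWithin (Metric.isOpen_ball.uniqueDiffWithinAt hs)
  exact h2.hasDerivWithinAt.nonneg_of_monotoneOn
    (uniqueDiffWithinAt_iff_accPt.mp
      (Metric.isOpen_ball.uniqueDiffWithinAt (Metric.mem_ball_self hε))) hm'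

/-! ### C) and D) as square-root inequalities -/

lemma or_iff_sqrt_add_nonneg {A B T E κ : ℝ} (hκ : 0 < κ) (e : A * B - T ^ 2 = κ * E) :
    (0 ≤ T ∨ 0 ≤ E) ↔ 0 ≤ √(A * B) + T := by
  constructor
  · rintro (hT | hE)
    · positivity
    · have : |T| ≤ √(A * B) := Real.abs_le_sqrt (by nlinarith [mul_nonneg hκ.le hE])
      linarith [neg_abs_le T]
  · intro h
    by_contra! hc
    have h1 : -T ≤ √(A * B) := by linarith
    have h2 := (Real.le_sqrt' (by linarith : 0 < -T)).mp h1
    nlinarith [mul_neg_of_pos_of_neg hκ hc.2]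

/-- The second alternative of C) is AB - T² ≥ 0 up to the positive factor κ = 2t/(t-1)². It forces
AB ≥ 0, so the equivalence needs no A). -/
lemma conditionC_iff {h f : ℝ → ℝ} : ConditionC h f ↔ ∀ t z : ℝ, 0 < t → 0 < z → t ≠ 1 →
    0 ≤ √((t ^ 2 * deriv (deriv h) t + z ^ 2 * deriv (deriv f) z) *
      (t ^ 2 * deriv (deriv h) t + 2 * (t * deriv h t) + z ^ 2 * deriv (deriv f) z)) +
      (2 * t / (t - 1) * deriv h t - t ^ 2 * deriv (deriv h) t + z ^ 2 * deriv (deriv f) z) := by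
  refine forall₅_congr fun t z ht _ ht1 => ?_
  have h1 : t - 1 ≠ 0 := sub_ne_zero.mpr ht1
  refine or_iff_sqrt_add_nonneg (κ := 2 * t / (t - 1) ^ 2) (by positivity) ?_
  rw [coeffA, coeffB, coeffC]
  field_simp
  ring

lemma conditionD_iff {h f : ℝ → ℝ} : ConditionD h f ↔ ∀ t z : ℝ, 0 < t → 0 < z →
    0 ≤ √((t ^ 2 * deriv (deriv h) t + z ^ 2 * deriv (deriv f) z) *
      (t ^ 2 * deriv (deriv h) t + 2 * (t * deriv h t) + z ^ 2 * deriv (deriv f) z)) +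
      (2 * t / (t + 1) * deriv h t + t ^ 2 * deriv (deriv h) t - z ^ 2 * deriv (deriv f) z) := by
  refine forall₄_congr fun t z ht _ => ?_
  refine or_iff_sqrt_add_nonneg (κ := 2 * t / (t + 1) ^ 2) (by positivity) ?_
  rw [coeffA, coeffB, coeffC]
  field_simp
  ring

lemma div_nonneg_iff_of_pos' {a b : ℝ} (hb : 0 < b) : 0 ≤ a / b ↔ 0 ≤ a := by
  rw [le_div_iff₀ hb, zero_mul]

lemma exists_div_eq_mul_eq {t z : ℝ} (ht : 0 < t) (hz : 0 < z) :
    ∃ x y : ℝ, 0 < x ∧ 0 < y ∧ x / y = t ∧ x * y = z := by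
  refine ⟨√(t * z), √(z / t), by positivity, by positivity, ?_, ?_⟩
  · rw [← Real.sqrt_div (by positivity), ← Real.sqrt_sq ht.le]
    congr 1
    rw [Real.sqrt_sq ht.le]; field_simp
  · rw [← Real.sqrt_mul (by positivity), ← Real.sqrt_sq hz.le]
    congr 1
    rw [Real.sqrt_sq hz.le]; field_simp

/-! ### Partial derivatives of g -/

section Partials

variable {h f : ℝ → ℝ} {x y : ℝ}

lemma hasDerivAt_comp_div_left {k : ℝ → ℝ} {k' : ℝ} (hk : HasDerivAt k k' (x / y)) :
    HasDerivAt (fun s => k (s / y)) (k' * (1 / y)) x :=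
  hk.comp x ((hasDerivAt_id x).div_const y)

lemma hasDerivAt_comp_div_right {k : ℝ → ℝ} {k' : ℝ} (hk : HasDerivAt k k' (x / y)) (hy : y ≠ 0) :
    HasDerivAt (fun s => k (x / s)) (k' * -(x / y ^ 2)) y := by
  have hd : HasDerivAt (fun s => x / s) (-(x / y ^ 2)) y :=
    ((hasDerivAt_const y x).div (hasDerivAt_id y) hy).congr_deriv (by simp only [id]; ring)
  exact hk.comp y hd

lemma hasDerivAt_comp_mul_left {k : ℝ → ℝ} {k' : ℝ} (hk : HasDerivAt k k' (x * y)) :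
    HasDerivAt (fun s => k (s * y)) (k' * y) x :=
  (hk.comp x ((hasDerivAt_id x).mul_const y)).congr_deriv (by rw [one_mul])

lemma hasDerivAt_comp_mul_right {k : ℝ → ℝ} {k' : ℝ} (hk : HasDerivAt k k' (x * y)) :
    HasDerivAt (fun s => k (x * s)) (k' * x) y :=
  (hk.comp y ((hasDerivAt_id y).const_mul x)).congr_deriv (by rw [mul_one])

lemma dx_volIso (hh : ContDiffOn ℝ 2 h (Set.Ioi 0)) (hf : ContDiffOn ℝ 2 f (Set.Ioi 0))
    (hx : 0 < x) (hy : 0 < y) :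
    dx (volIso h f) x y = deriv h (x / y) / y + y * deriv f (x * y) := by
  have h1 := hasDerivAt_comp_div_left (hasDerivAt_deriv_of_contDiffOn hh (div_pos hx hy)).1
  have f1 := hasDerivAt_comp_mul_left (hasDerivAt_deriv_of_contDiffOn hf (mul_pos hx hy)).1
  refine (h1.add f1).deriv.trans ?_
  ring

lemma dy_volIso (hh : ContDiffOn ℝ 2 h (Set.Ioi 0)) (hf : ContDiffOn ℝ 2 f (Set.Ioi 0))
    (hx : 0 < x) (hy : 0 < y) :
    dy (volIso h f) x y = -(x / y ^ 2) * deriv h (x / y) + x * deriv f (x * y) := by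
  have h1 := hasDerivAt_comp_div_right (hasDerivAt_deriv_of_contDiffOn hh (div_pos hx hy)).1 hy.ne'
  have f1 := hasDerivAt_comp_mul_right (hasDerivAt_deriv_of_contDiffOn hf (mul_pos hx hy)).1
  refine (h1.add f1).deriv.trans ?_
  ring

lemma dxx_volIso (hh : ContDiffOn ℝ 2 h (Set.Ioi 0)) (hf : ContDiffOn ℝ 2 f (Set.Ioi 0))
    (hx : 0 < x) (hy : 0 < y) :
    dxx (volIso h f) x y =
      ((x / y) ^ 2 * deriv (deriv h) (x / y) + (x * y) ^ 2 * deriv (deriv f) (x * y)) / x ^ 2 := by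
  have h1 := hasDerivAt_comp_div_left (hasDerivAt_deriv_of_contDiffOn hh (div_pos hx hy)).2
  have f1 := hasDerivAt_comp_mul_left (hasDerivAt_deriv_of_contDiffOn hf (mul_pos hx hy)).2
  have e : (fun s => dx (volIso h f) s y) =ᶠ[nhds x]
      fun s => deriv h (s / y) / y + y * deriv f (s * y) := by
    filter_upwards [Ioi_mem_nhds hx] with s hs using dx_volIso hh hf hs hy
  refine e.deriv_eq.trans (((h1.div_const y).add (f1.const_mul y)).deriv.trans ?_)
  field_simp

lemma dxy_volIso (hh : ContDiffOn ℝ 2 h (Set.Ioi 0)) (hf : ContDiffOn ℝ 2 f (Set.Ioi 0))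
    (hx : 0 < x) (hy : 0 < y) :
    dxy (volIso h f) x y =
      (-(x / y * deriv h (x / y)) - (x / y) ^ 2 * deriv (deriv h) (x / y) +
        x * y * deriv f (x * y) + (x * y) ^ 2 * deriv (deriv f) (x * y)) / (x * y) := by
  have h1 := hasDerivAt_comp_div_left (hasDerivAt_deriv_of_contDiffOn hh (div_pos hx hy)).2
  have f1 := hasDerivAt_comp_mul_left (hasDerivAt_deriv_of_contDiffOn hf (mul_pos hx hy)).2
  have e : (fun s => dy (volIso h f) s y) =ᶠ[nhds x]
      fun s => -(s / y ^ 2) * deriv h (s / y) + s * deriv f (s * y) := by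
    filter_upwards [Ioi_mem_nhds hx] with s hs using dy_volIso hh hf hs hy
  refine e.deriv_eq.trans (((((hasDerivAt_id x).div_const (y ^ 2)).neg.mul h1).add
    ((hasDerivAt_id x).mul f1)).deriv.trans ?_)
  simp only [id, Pi.neg_apply]
  field_simp
  ring

lemma dyy_volIso (hh : ContDiffOn ℝ 2 h (Set.Ioi 0)) (hf : ContDiffOn ℝ 2 f (Set.Ioi 0))
    (hx : 0 < x) (hy : 0 < y) :
    dyy (volIso h f) x y =
      ((x / y) ^ 2 * deriv (deriv h) (x / y) + 2 * (x / y * deriv h (x / y)) +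
        (x * y) ^ 2 * deriv (deriv f) (x * y)) / y ^ 2 := by
  have h1 := hasDerivAt_comp_div_right (hasDerivAt_deriv_of_contDiffOn hh (div_pos hx hy)).2 hy.ne'
  have f1 := hasDerivAt_comp_mul_right (hasDerivAt_deriv_of_contDiffOn hf (mul_pos hx hy)).2
  have e : (fun s => dy (volIso h f) x s) =ᶠ[nhds y]
      fun s => -(x / s ^ 2) * deriv h (x / s) + x * deriv f (x * s) := by
    filter_upwards [Ioi_mem_nhds hy] with s hs using dy_volIso hh hf hx hs
  have hd : HasDerivAt (fun s => -(x / s ^ 2)) (2 * x / y ^ 3) y :=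
    ((hasDerivAt_const y x).div (hasDerivAt_pow 2 y) (pow_ne_zero 2 hy.ne')).neg.congr_deriv
      (by field_simp; norm_num; ring)
  refine e.deriv_eq.trans (((hd.mul h1).add (f1.const_mul x)).deriv.trans ?_)
  field_simp
  ring

end Partials

/-! ### Equivalence with the Knowles–Sternberg conditions -/

section KnowlesSternberg

variable {h f : ℝ → ℝ}

/-- This is A) at 1/t: inversion exchanges the two stretches, so A) also controls the coefficient
belonging to g_yy. -/
lemma ConditionA.inv (hh : ContDiffOn ℝ 2 h (Set.Ioi 0))
    (hsymm : ∀ t : ℝ, 0 < t → h t = h (1 / t)) (hA : ConditionA h f) {t z : ℝ}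
    (ht : 0 < t) (hz : 0 < z) :
    0 ≤ t ^ 2 * deriv (deriv h) t + 2 * (t * deriv h t) + z ^ 2 * deriv (deriv f) z := by
  have := hA (1 / t) z (one_div_pos.mpr ht) hz
  rw [deriv_deriv_inv hh hsymm ht] at this
  convert this using 2
  field_simp

lemma conditionA_iff_knowlesSternbergI (hh : ContDiffOn ℝ 2 h (Set.Ioi 0))
    (hf : ContDiffOn ℝ 2 f (Set.Ioi 0)) (hsymm : ∀ t : ℝ, 0 < t → h t = h (1 / t)) :
    ConditionA h f ↔ KnowlesSternbergI (volIso h f) := by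
  constructor
  · intro hA x y hx hy
    rw [dxx_volIso hh hf hx hy, dyy_volIso hh hf hx hy]
    exact ⟨div_nonneg (hA _ _ (div_pos hx hy) (mul_pos hx hy)) (sq_nonneg _),
      div_nonneg (hA.inv hh hsymm (div_pos hx hy) (mul_pos hx hy)) (sq_nonneg _)⟩
  · intro H t z ht hz
    obtain ⟨x, y, hx, hy, rfl, rfl⟩ := exists_div_eq_mul_eq ht hz
    have := (H x y hx hy).1
    rw [dxx_volIso hh hf hx hy] at this
    exact (div_nonneg_iff_of_pos' (by positivity)).mp this

lemma conditionB_iff_knowlesSternbergII (hh : ContDiffOn ℝ 2 h (Set.Ioi 0))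
    (hf : ContDiffOn ℝ 2 f (Set.Ioi 0)) (hsymm : ∀ t : ℝ, 0 < t → h t = h (1 / t)) :
    ConditionB h ↔ KnowlesSternbergII (volIso h f) := by
  have key {x y : ℝ} (hx : 0 < x) (hy : 0 < y) (hxy : x ≠ y) :
      (x * dx (volIso h f) x y - y * dy (volIso h f) x y) / (x - y) =
        deriv h (x / y) * (x / y - 1) * (2 * x / (x - y) ^ 2) := by
    have := sub_ne_zero.mpr hxy
    rw [dx_volIso hh hf hx hy, dy_volIso hh hf hx hy]
    field_simp
    ring
  constructor
  · intro hB x y hx hy hxy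
    rw [key hx hy hxy]
    exact mul_nonneg (hB.mul_sub_nonneg hh hsymm (div_pos hx hy)) (by positivity)
  · intro H t ht
    rcases ht.eq_or_lt with rfl | ht
    · rw [deriv_one_eq_zero hh hsymm]
    · have h0 : 0 < t := by linarith
      have := H t 1 h0 one_pos ht.ne'
      rw [key h0 one_pos ht.ne', div_one] at this
      have h1 : 0 < (t - 1) * (2 * t / (t - 1) ^ 2) := by
        have : 0 < t - 1 := by linarith
        positivity
      rw [mul_assoc] at this
      exact nonneg_of_mul_nonneg_left this h1

lemma sqrt_dxx_mul_dyy (hh : ContDiffOn ℝ 2 h (Set.Ioi 0))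
    (hf : ContDiffOn ℝ 2 f (Set.Ioi 0)) {x y : ℝ} (hx : 0 < x) (hy : 0 < y) :
    √(dxx (volIso h f) x y * dyy (volIso h f) x y) =
      √(((x / y) ^ 2 * deriv (deriv h) (x / y) + (x * y) ^ 2 * deriv (deriv f) (x * y)) *
        ((x / y) ^ 2 * deriv (deriv h) (x / y) + 2 * (x / y * deriv h (x / y)) +
          (x * y) ^ 2 * deriv (deriv f) (x * y))) / (x * y) := by
  rw [dxx_volIso hh hf hx hy, dyy_volIso hh hf hx hy, div_mul_div_comm, ← mul_pow,
    Real.sqrt_div' _ (by positivity), Real.sqrt_sq (by positivity)]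

lemma conditionC_iff_knowlesSternbergIV (hh : ContDiffOn ℝ 2 h (Set.Ioi 0))
    (hf : ContDiffOn ℝ 2 f (Set.Ioi 0)) :
    ConditionC h f ↔ KnowlesSternbergIV (volIso h f) := by
  have key {x y : ℝ} (hx : 0 < x) (hy : 0 < y) (hxy : x ≠ y) :
      dxy (volIso h f) x y + (dx (volIso h f) x y - dy (volIso h f) x y) / (x - y) =
        (2 * (x / y) / (x / y - 1) * deriv h (x / y) - (x / y) ^ 2 * deriv (deriv h) (x / y) +
          (x * y) ^ 2 * deriv (deriv f) (x * y)) / (x * y) := by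
    have := sub_ne_zero.mpr hxy
    have e : x / y - 1 = (x - y) / y := by field_simp
    rw [dxy_volIso hh hf hx hy, dx_volIso hh hf hx hy, dy_volIso hh hf hx hy, e]
    field_simp
    ring
  rw [conditionC_iff]
  constructor
  · intro H x y hx hy hxy
    rw [add_assoc, sqrt_dxx_mul_dyy hh hf hx hy, key hx hy hxy, ← add_div]
    refine div_nonneg (H _ _ (div_pos hx hy) (mul_pos hx hy) ?_) (by positivity)
    rwa [Ne, div_eq_one_iff_eq hy.ne']
  · intro H t z ht hz ht1
    obtain ⟨x, y, hx, hy, rfl, rfl⟩ := exists_div_eq_mul_eq ht hz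
    have hxy : x ≠ y := by rintro rfl; exact ht1 (div_self hx.ne')
    have := H x y hx hy hxy
    rw [add_assoc, sqrt_dxx_mul_dyy hh hf hx hy, key hx hy hxy, ← add_div] at this
    exact (div_nonneg_iff_of_pos' (by positivity)).mp this

lemma conditionD_iff_knowlesSternbergV (hh : ContDiffOn ℝ 2 h (Set.Ioi 0))
    (hf : ContDiffOn ℝ 2 f (Set.Ioi 0)) :
    ConditionD h f ↔ KnowlesSternbergV (volIso h f) := by
  have key {x y : ℝ} (hx : 0 < x) (hy : 0 < y) :
      -dxy (volIso h f) x y + (dx (volIso h f) x y + dy (volIso h f) x y) / (x + y) =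
        (2 * (x / y) / (x / y + 1) * deriv h (x / y) + (x / y) ^ 2 * deriv (deriv h) (x / y) -
          (x * y) ^ 2 * deriv (deriv f) (x * y)) / (x * y) := by
    have e : x / y + 1 = (x + y) / y := by field_simp
    rw [dxy_volIso hh hf hx hy, dx_volIso hh hf hx hy, dy_volIso hh hf hx hy, e]
    field_simp
    ring
  rw [conditionD_iff]
  constructor
  · intro H x y hx hy
    rw [sub_eq_add_neg, add_assoc, sqrt_dxx_mul_dyy hh hf hx hy, key hx hy, ← add_div]
    exact div_nonneg (H _ _ (div_pos hx hy) (mul_pos hx hy)) (by positivity)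
  · intro H t z ht hz
    obtain ⟨x, y, hx, hy, rfl, rfl⟩ := exists_div_eq_mul_eq ht hz
    have := H x y hx hy
    rw [sub_eq_add_neg, add_assoc, sqrt_dxx_mul_dyy hh hf hx hy, key hx hy, ← add_div] at this
    exact (div_nonneg_iff_of_pos' (by positivity)).mp this

/-- Symmetry gives h'(1) = 0, so h''(1) is a limit of slopes h'(t)/(t-1) ≥ 0 as t ↓ 1. At x = y both
expressions collapse to 2h''(1)/x². -/
lemma ConditionB.knowlesSternbergIII (hh : ContDiffOn ℝ 2 h (Set.Ioi 0))
    (hf : ContDiffOn ℝ 2 f (Set.Ioi 0)) (hsymm : ∀ t : ℝ, 0 < t → h t = h (1 / t))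
    (hB : ConditionB h) : KnowlesSternbergIII (volIso h f) := by
  have h0 := deriv_one_eq_zero hh hsymm
  have h2 : 0 ≤ deriv (deriv h) 1 := by
    have hd := (hasDerivAt_deriv_of_contDiffOn hh one_pos).2.tendsto_slope.mono_left
      (nhdsWithin_mono 1 (fun t (ht : t ∈ Set.Ioi 1) => ht.ne'))
    refine ge_of_tendsto hd ?_
    filter_upwards [self_mem_nhdsWithin] with t ht
    have ht' : (1 : ℝ) < t := ht
    rw [slope_def_field, h0, sub_zero]
    exact div_nonneg (hB t ht'.le) (by linarith)
  intro x y hx hy hxy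
  subst hxy
  rw [dxx_volIso hh hf hx hx, dyy_volIso hh hf hx hx, dxy_volIso hh hf hx hx,
    dx_volIso hh hf hx hx, dy_volIso hh hf hx hx, div_self hx.ne', h0]
  have e : 0 ≤ 2 * deriv (deriv h) 1 / x ^ 2 := by positivity
  constructor <;>
  · refine e.trans_eq ?_
    field_simp
    ring

end KnowlesSternberg

/-! ### The two moduli along a rank-one line -/

section Lines

variable (F : Matrix (Fin 2) (Fin 2) ℝ) (ξ η : Fin 2 → ℝ) (s : ℝ)

lemma confNorm_add_smul : confNorm (F + s • Matrix.vecMulVec ξ η) =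
    √(((F 0 0 + F 1 1) / 2 + s * ((ξ 0 * η 0 + ξ 1 * η 1) / 2)) ^ 2 +
      ((F 1 0 - F 0 1) / 2 + s * ((ξ 1 * η 0 - ξ 0 * η 1) / 2)) ^ 2) := by
  simp only [confNorm, Matrix.add_apply, Matrix.smul_apply, Matrix.vecMulVec_apply, smul_eq_mul]
  ring_nf

lemma antiNorm_add_smul : antiNorm (F + s • Matrix.vecMulVec ξ η) =
    √(((F 0 0 - F 1 1) / 2 + s * ((ξ 0 * η 0 - ξ 1 * η 1) / 2)) ^ 2 +
      ((F 1 0 + F 0 1) / 2 + s * ((ξ 1 * η 0 + ξ 0 * η 1) / 2)) ^ 2) := by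
  simp only [antiNorm, Matrix.add_apply, Matrix.smul_apply, Matrix.vecMulVec_apply, smul_eq_mul]
  ring_nf

lemma det_add_smul : (F + s • Matrix.vecMulVec ξ η).det =
    F.det + s * (F 0 0 * ξ 1 * η 1 + F 1 1 * ξ 0 * η 0 - F 0 1 * ξ 1 * η 0 - F 1 0 * ξ 0 * η 1) := by
  simp only [Matrix.det_fin_two, Matrix.add_apply, Matrix.smul_apply, Matrix.vecMulVec_apply,
    smul_eq_mul]
  ring

lemma isOpen_det_pos : IsOpen {s : ℝ | 0 < (F + s • Matrix.vecMulVec ξ η).det} := by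
  simp only [det_add_smul]
  exact isOpen_lt (by fun_prop) (by fun_prop)

lemma convex_det_pos : Convex ℝ {s : ℝ | 0 < (F + s • Matrix.vecMulVec ξ η).det} := by
  intro s hs t ht a b ha hb hab
  simp only [Set.mem_ofPred_eq, det_add_smul, smul_eq_mul] at *
  generalize F 0 0 * ξ 1 * η 1 + F 1 1 * ξ 0 * η 0 - F 0 1 * ξ 1 * η 0 - F 1 0 * ξ 0 * η 1 = c at *
  have e : F.det + (a * s + b * t) * c = a * (F.det + s * c) + b * (F.det + t * c) := by
    linear_combination -F.det * hab
  rw [e]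
  rcases ha.eq_or_lt with rfl | ha
  · rw [zero_mul, zero_add]
    exact mul_pos (by linarith) ht
  · exact add_pos_of_pos_of_nonneg (mul_pos ha hs) (mul_nonneg hb ht.le)

/-- The conformal modulus along a rank-one line in the orientation preserving matrices. -/
lemma exists_isModulus_confNorm {U : Set ℝ}
    (hU : ∀ s ∈ U, 0 < (F + s • Matrix.vecMulVec ξ η).det) {r : ℝ}
    (hr : r ^ 2 = (ξ 0 ^ 2 + ξ 1 ^ 2) * (η 0 ^ 2 + η 1 ^ 2) / 4) :
    ∃ P₁ P₂, IsModulus U r (fun s => confNorm (F + s • Matrix.vecMulVec ξ η)) P₁ P₂ ∧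
      P₁ 0 = ((F 0 0 + F 1 1) / 2 * ((ξ 0 * η 0 + ξ 1 * η 1) / 2) +
        (F 1 0 - F 0 1) / 2 * ((ξ 1 * η 0 - ξ 0 * η 1) / 2)) / confNorm F := by
  have hpos : ∀ s ∈ U, 0 < confNorm (F + s • Matrix.vecMulVec ξ η) := fun s hs =>
    (Real.sqrt_nonneg _).trans_lt (antiNorm_lt_confNorm (hU s hs))
  have hP : (fun s : ℝ => confNorm (F + s • Matrix.vecMulVec ξ η)) = fun s => _ :=
    funext fun s => confNorm_add_smul F ξ η s
  simp only [confNorm_add_smul] at hpos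
  rw [hP]
  refine ⟨_, _, isModulus_sqrt ?_ hpos, ?_⟩
  · rw [hr]; ring
  · simp only [zero_mul, add_zero, confNorm]

lemma exists_isModulus_antiNorm {U : Set ℝ}
    (hU : ∀ s ∈ U, 0 < antiNorm (F + s • Matrix.vecMulVec ξ η)) {r : ℝ}
    (hr : r ^ 2 = (ξ 0 ^ 2 + ξ 1 ^ 2) * (η 0 ^ 2 + η 1 ^ 2) / 4) :
    ∃ ρ₁ ρ₂, IsModulus U r (fun s => antiNorm (F + s • Matrix.vecMulVec ξ η)) ρ₁ ρ₂ ∧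
      ρ₁ 0 = ((F 0 0 - F 1 1) / 2 * ((ξ 0 * η 0 - ξ 1 * η 1) / 2) +
        (F 1 0 + F 0 1) / 2 * ((ξ 1 * η 0 + ξ 0 * η 1) / 2)) / antiNorm F := by
  have hρ : (fun s : ℝ => antiNorm (F + s • Matrix.vecMulVec ξ η)) = fun s => _ :=
    funext fun s => antiNorm_add_smul F ξ η s
  simp only [antiNorm_add_smul] at hU
  rw [hρ]
  refine ⟨_, _, isModulus_sqrt ?_ hU, ?_⟩
  · rw [hr]; ring
  · simp only [zero_mul, add_zero, antiNorm]

end Lines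

/-! ### Sufficiency of A)–D) -/

section Sufficiency

variable {h f : ℝ → ℝ}

lemma convexOn_volIso_of_isModulus (hh : ContDiffOn ℝ 2 h (Set.Ioi 0))
    (hf : ContDiffOn ℝ 2 f (Set.Ioi 0)) (hsymm : ∀ t : ℝ, 0 < t → h t = h (1 / t))
    (hA : ConditionA h f) (hB : ConditionB h) (hC : ConditionC h f) (hD : ConditionD h f)
    {S : Set ℝ} (hconv : Convex ℝ S) {r : ℝ} {P P₁ P₂ ρ ρ₁ ρ₂ : ℝ → ℝ}
    (HP : IsModulus S r P P₁ P₂) (Hρ : IsModulus S r ρ ρ₁ ρ₂) (hlt : ∀ s ∈ S, |ρ s| < P s)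
    (hρ0 : ∀ s ∈ S, ρ s = 0 → ρ₂ s = 0) :
    ConvexOn ℝ S (fun s => volIso h f (P s + ρ s) (P s - ρ s)) := by
  have hder {s : ℝ} (hs : s ∈ S) := hasDerivAt_energy hh hf HP Hρ hlt hs
  refine convexOn_of_hasDerivWithinAt2_nonneg hconv
    (fun s hs => (hder hs).1.continuousAt.continuousWithinAt)
    (f' := energyDeriv h f P P₁ ρ ρ₁) (f'' := energyDeriv₂ h f P P₁ P₂ ρ ρ₁ ρ₂)
    (fun s hs => (hder (interior_subset hs)).1.hasDerivWithinAt)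
    (fun s hs => (hder (interior_subset hs)).2.hasDerivWithinAt) fun s hs => ?_
  replace hs := interior_subset hs
  obtain ⟨hl1, hl2⟩ := abs_lt.mp (hlt s hs)
  have hP : 0 < P s := (abs_nonneg _).trans_lt (hlt s hs)
  have hx : 0 < P s + ρ s := by linarith
  have hy : 0 < P s - ρ s := by linarith
  have ht := div_pos hx hy
  have hz := mul_pos hx hy
  have key := sq_mul_energyDeriv₂ (h := h) (f := f) (P₁ := P₁) (P₂ := P₂) (ρ₁ := ρ₁) (ρ₂ := ρ₂)
    (hlt s hs) rfl rfl rfl rfl rfl rfl rfl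
  refine nonneg_of_mul_nonneg_right ?_ (pow_pos hz 2)
  rw [key]
  have e1 : (P s + ρ s) / (P s - ρ s) + 1 = 2 * P s / (P s - ρ s) := by field_simp; ring
  have e2 : (P s + ρ s) / (P s - ρ s) - 1 = 2 * ρ s / (P s - ρ s) := by field_simp; ring
  refine energy_form_nonneg rfl rfl (hlt s hs) (HP.mul_eq s hs) (Hρ.mul_eq s hs) (HP.sq_le s hs)
    (Hρ.sq_le s hs) (hρ0 s hs) (hA _ _ ht hz) (hA.inv hh hsymm ht hz) ?_ (fun hne => ?_) ?_
  · have hb := hB.mul_sub_nonneg hh hsymm ht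
    rw [e2] at hb
    have : 0 ≤ deriv h ((P s + ρ s) / (P s - ρ s)) * (2 * ρ s / (P s - ρ s)) *
        ((P s + ρ s) / 2) := mul_nonneg hb (by positivity)
    refine this.trans_eq ?_
    field_simp
  · have hne' : (P s + ρ s) / (P s - ρ s) ≠ 1 := by
      intro e
      rw [e, sub_self, eq_comm, div_eq_zero_iff] at e2
      rcases e2 with e2 | e2
      · exact hne (by linarith)
      · exact hy.ne' e2
    have hc := conditionC_iff.mp hC _ _ ht hz hne'
    rw [e2] at hc
    convert hc using 4
    field_simp
  · have hd := conditionD_iff.mp hD _ _ ht hz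
    rw [e1] at hd
    convert hd using 4
    field_simp

lemma rankOneConvexGLPos_of_conditions (hh : ContDiffOn ℝ 2 h (Set.Ioi 0))
    (hf : ContDiffOn ℝ 2 f (Set.Ioi 0)) (hsymm : ∀ t : ℝ, 0 < t → h t = h (1 / t))
    {W : Matrix (Fin 2) (Fin 2) ℝ → ℝ}
    (hW : ∀ F : Matrix (Fin 2) (Fin 2) ℝ, 0 < F.det → W F = volIso h f (sigma1 F) (sigma2 F))
    (hA : ConditionA h f) (hB : ConditionB h) (hC : ConditionC h f) (hD : ConditionD h f) :
    RankOneConvexGLPos W := by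
  intro F _ ξ η
  set S := {s : ℝ | 0 < (F + s • Matrix.vecMulVec ξ η).det}
  set r := √((ξ 0 ^ 2 + ξ 1 ^ 2) * (η 0 ^ 2 + η 1 ^ 2) / 4)
  have hr : r ^ 2 = (ξ 0 ^ 2 + ξ 1 ^ 2) * (η 0 ^ 2 + η 1 ^ 2) / 4 := Real.sq_sqrt (by positivity)
  obtain ⟨P₁, P₂, HP, -⟩ := exists_isModulus_confNorm F ξ η (U := S) (fun s hs => hs) hr
  suffices H : ∃ ρ ρ₁ ρ₂, IsModulus S r ρ ρ₁ ρ₂ ∧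
      (∀ s ∈ S, ρ s ^ 2 = antiNorm (F + s • Matrix.vecMulVec ξ η) ^ 2) ∧
      ∀ s ∈ S, ρ s = 0 → ρ₂ s = 0 by
    obtain ⟨ρ, ρ₁, ρ₂, Hρ, hsq, hρ0⟩ := H
    refine (convexOn_volIso_of_isModulus hh hf hsymm hA hB hC hD (convex_det_pos F ξ η)
      HP Hρ (fun s hs => abs_lt_confNorm hs (hsq s hs))
      hρ0).congr fun s hs => ?_
    exact ((hW _ hs).trans (volIso_sigma_eq hsymm hs (hsq s hs))).symm
  by_cases hzero : ∃ s₀ ∈ S, antiNorm (F + s₀ • Matrix.vecMulVec ξ η) = 0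
  · obtain ⟨s₀, -, h0⟩ := hzero
    -- If q vanishes at s₀, then |q| = |s - s₀| r may have a corner there; the signed modulus (s -
    -- s₀) r does not.
    refine ⟨_, _, _, isModulus_linear S r (-(s₀ * r)), fun s _ => ?_, fun _ _ _ => rfl⟩
    rw [antiNorm_add_smul, Real.sqrt_eq_zero (by positivity)] at h0
    rw [antiNorm_add_smul, Real.sq_sqrt (by positivity)]
    obtain ⟨h1, h2⟩ := (add_eq_zero_iff_of_nonneg (sq_nonneg _) (sq_nonneg _)).mp h0
    rw [sq_eq_zero_iff] at h1 h2
    have e : (-(s₀ * r) + s * r) ^ 2 = (s - s₀) ^ 2 * r ^ 2 := by ring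
    rw [e, hr, eq_neg_of_add_eq_zero_left h1, eq_neg_of_add_eq_zero_left h2]
    ring
  · push Not at hzero
    obtain ⟨ρ₁, ρ₂, Hρ, -⟩ := exists_isModulus_antiNorm F ξ η (U := S)
      (fun s hs => (Real.sqrt_nonneg _).lt_of_ne (hzero s hs).symm) hr
    exact ⟨_, ρ₁, ρ₂, Hρ, fun _ _ => rfl, fun s hs hs0 => (hzero s hs hs0).elim⟩

end Sufficiency

/-! ### Necessity of A)–D) -/

section Necessity

variable {h f : ℝ → ℝ} {W : Matrix (Fin 2) (Fin 2) ℝ → ℝ}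

/-- The signed modulus ρ is left free: D) uses a linear one, valid even at x = y, while B) and C)
use ±|q| away from its zeros. -/
lemma energy_form_nonneg_of_rankOneConvex (hh : ContDiffOn ℝ 2 h (Set.Ioi 0))
    (hf : ContDiffOn ℝ 2 f (Set.Ioi 0)) (hsymm : ∀ t : ℝ, 0 < t → h t = h (1 / t))
    (hW : ∀ F : Matrix (Fin 2) (Fin 2) ℝ, 0 < F.det → W F = volIso h f (sigma1 F) (sigma2 F))
    (hconv : RankOneConvexGLPos W) {x y : ℝ} (hx : 0 < x) (hy : 0 < y) (ξ η : Fin 2 → ℝ) {r : ℝ}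
    (hr : r ^ 2 = (ξ 0 ^ 2 + ξ 1 ^ 2) * (η 0 ^ 2 + η 1 ^ 2) / 4) {U : Set ℝ} (hU : IsOpen U)
    (h0U : 0 ∈ U) (hdet : ∀ s ∈ U, 0 < (!![x, 0; 0, y] + s • Matrix.vecMulVec ξ η).det)
    {ρ ρ₁ ρ₂ : ℝ → ℝ} (Hρ : IsModulus U r ρ ρ₁ ρ₂)
    (hsq : ∀ s ∈ U, ρ s ^ 2 = antiNorm (!![x, 0; 0, y] + s • Matrix.vecMulVec ξ η) ^ 2)
    (hρ0 : ρ 0 = (x - y) / 2) {t z u v w a : ℝ}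
    (ht : t = x / y) (hz : z = x * y) (hu : u = t ^ 2 * deriv (deriv h) t) (hv : v = t * deriv h t)
    (hw : w = z ^ 2 * deriv (deriv f) z) (ha : a = (ξ 0 * η 0 + ξ 1 * η 1) / 2) :
    0 ≤ (u + w) * ((a + ρ₁ 0) * y) ^ 2 + (u + 2 * v + w) * ((a - ρ₁ 0) * x) ^ 2 +
      2 * ((a + ρ₁ 0) * y * ((a - ρ₁ 0) * x)) * (w - u - v) +
      2 * v * (x * y) * ((x + y) / 2 * ρ₂ 0 - (x - y) / 2 * ((r ^ 2 - a ^ 2) / ((x + y) / 2))) := by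
  set F : Matrix (Fin 2) (Fin 2) ℝ := !![x, 0; 0, y] with hF
  have hFdet : 0 < F.det := by rw [hF, Matrix.det_fin_two_of]; nlinarith [mul_pos hx hy]
  obtain ⟨P₁, P₂, HP, hP1⟩ := exists_isModulus_confNorm F ξ η hdet hr
  have hP0 : confNorm F = (x + y) / 2 := by
    rw [confNorm]
    simp only [hF, Matrix.of_apply, Matrix.cons_val', Matrix.cons_val_zero, Matrix.cons_val_one,
      Matrix.cons_val_fin_one]
    rw [sub_self, zero_div, zero_pow two_ne_zero, add_zero, Real.sqrt_sq (by positivity)]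
  have hP1' : P₁ 0 = a := by
    rw [hP1, hP0, ha]
    simp only [hF, Matrix.of_apply, Matrix.cons_val', Matrix.cons_val_zero, Matrix.cons_val_one,
      Matrix.cons_val_fin_one]
    field_simp
    ring
  have hPz : confNorm (F + (0 : ℝ) • Matrix.vecMulVec ξ η) = (x + y) / 2 := by
    rw [zero_smul, add_zero, hP0]
  have hP2' : P₂ 0 = (r ^ 2 - a ^ 2) / ((x + y) / 2) := by
    have := HP.mul_eq 0 h0U
    rw [hPz, hP1'] at this
    rw [← this]; field_simp
  have hlt : ∀ s ∈ U, |ρ s| < confNorm (F + s • Matrix.vecMulVec ξ η) :=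
    fun s hs => abs_lt_confNorm (hdet s hs) (hsq s hs)
  have hder {s : ℝ} (hs : s ∈ U) := hasDerivAt_energy hh hf HP Hρ hlt hs
  have hnn : 0 ≤ energyDeriv₂ h f (fun s => confNorm (F + s • Matrix.vecMulVec ξ η)) P₁ P₂
      ρ ρ₁ ρ₂ 0 := by
    refine (hconv F hFdet ξ η).second_deriv_nonneg hU hdet h0U
      (fun s hs => (hder hs).1.congr_of_eventuallyEq ?_) (hder h0U).2
    filter_upwards [hU.mem_nhds hs] with s' hs'
    exact (hW _ (hdet s' hs')).trans (volIso_sigma_eq hsymm (hdet s' hs') (hsq s' hs'))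
  have key := sq_mul_energyDeriv₂ (h := h) (f := f) (P₁ := P₁) (P₂ := P₂) (ρ₁ := ρ₁) (ρ₂ := ρ₂)
    (P := fun s => confNorm (F + s • Matrix.vecMulVec ξ η)) (ρ := ρ) (s := 0)
    (hlt 0 h0U) (x := x) (y := y) (by simp only [hPz, hρ0]; ring)
    (by simp only [hPz, hρ0]; ring) ht hz hu hv hw
  simp only [hP1', hP2', hPz, hρ0] at key
  rw [← key]
  exact mul_nonneg (sq_nonneg _) hnn

/-- For ξ = (α, β), η = (α, -β) at diag(x, y), q moves radially: ρ' = r, ρ'' = 0. With α² = m/y, β²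
= n/x the form is evaluated at (m, -n). -/
lemma quadratic_nonneg_of_rankOneConvex (hh : ContDiffOn ℝ 2 h (Set.Ioi 0))
    (hf : ContDiffOn ℝ 2 f (Set.Ioi 0)) (hsymm : ∀ t : ℝ, 0 < t → h t = h (1 / t))
    (hW : ∀ F : Matrix (Fin 2) (Fin 2) ℝ, 0 < F.det → W F = volIso h f (sigma1 F) (sigma2 F))
    (hconv : RankOneConvexGLPos W) {t z m n : ℝ} (ht : 0 < t) (hz : 0 < z) (hm : 0 ≤ m)
    (hn : 0 ≤ n) :
    0 ≤ (t ^ 2 * deriv (deriv h) t + z ^ 2 * deriv (deriv f) z) * m ^ 2 +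
      (t ^ 2 * deriv (deriv h) t + 2 * (t * deriv h t) + z ^ 2 * deriv (deriv f) z) * n ^ 2 +
      2 * (m * n) *
        (2 * t / (t + 1) * deriv h t + t ^ 2 * deriv (deriv h) t - z ^ 2 * deriv (deriv f) z) := by
  obtain ⟨x, y, hx, hy, rfl, rfl⟩ := exists_div_eq_mul_eq ht hz
  obtain ⟨α, hα2⟩ : ∃ α : ℝ, α ^ 2 = m / y := ⟨_, Real.sq_sqrt (by positivity)⟩
  obtain ⟨β, hβ2⟩ : ∃ β : ℝ, β ^ 2 = n / x := ⟨_, Real.sq_sqrt (by positivity)⟩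
  have H := energy_form_nonneg_of_rankOneConvex hh hf hsymm hW hconv hx hy ![α, β] ![α, -β]
    (r := (α ^ 2 + β ^ 2) / 2) (by simp; ring) (isOpen_det_pos _ _ _)
    (by simpa using mul_pos hx hy) (fun s hs => hs)
    (isModulus_linear _ _ ((x - y) / 2)) (fun s _ => by
      rw [antiNorm_add_smul, Real.sq_sqrt (by positivity)]
      simp
      ring) (by simp) rfl rfl rfl rfl rfl (a := (m / y - n / x) / 2) (by simp [← hα2, ← hβ2]; ring)
  rw [hα2, hβ2] at H
  refine H.trans_eq ?_
  generalize deriv (deriv h) (x / y) = d2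
  generalize deriv h (x / y) = d1
  generalize deriv (deriv f) (x * y) = e2
  have e : x / y + 1 = (x + y) / y := by field_simp
  rw [e]
  field_simp
  ring

lemma energy_form_nonneg_of_rankOneConvex_of_ne (hh : ContDiffOn ℝ 2 h (Set.Ioi 0))
    (hf : ContDiffOn ℝ 2 f (Set.Ioi 0)) (hsymm : ∀ t : ℝ, 0 < t → h t = h (1 / t))
    (hW : ∀ F : Matrix (Fin 2) (Fin 2) ℝ, 0 < F.det → W F = volIso h f (sigma1 F) (sigma2 F))
    (hconv : RankOneConvexGLPos W) {x y : ℝ} (hx : 0 < x) (hy : 0 < y) (hxy : x ≠ y)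
    (ξ η : Fin 2 → ℝ) {r : ℝ}
    (hr : r ^ 2 = (ξ 0 ^ 2 + ξ 1 ^ 2) * (η 0 ^ 2 + η 1 ^ 2) / 4) {t z u v w a c : ℝ}
    (ht : t = x / y) (hz : z = x * y) (hu : u = t ^ 2 * deriv (deriv h) t) (hv : v = t * deriv h t)
    (hw : w = z ^ 2 * deriv (deriv f) z) (ha : a = (ξ 0 * η 0 + ξ 1 * η 1) / 2)
    (hc : c = (ξ 0 * η 0 - ξ 1 * η 1) / 2) :
    0 ≤ (u + w) * ((a + c) * y) ^ 2 + (u + 2 * v + w) * ((a - c) * x) ^ 2 +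
      2 * ((a + c) * y * ((a - c) * x)) * (w - u - v) +
      2 * v * (x * y) * ((x + y) / 2 * ((r ^ 2 - c ^ 2) / ((x - y) / 2)) -
        (x - y) / 2 * ((r ^ 2 - a ^ 2) / ((x + y) / 2))) := by
  set F : Matrix (Fin 2) (Fin 2) ℝ := !![x, 0; 0, y] with hF
  set U := {s : ℝ | 0 < (F + s • Matrix.vecMulVec ξ η).det} ∩
    {s : ℝ | 0 < antiNorm (F + s • Matrix.vecMulVec ξ η)} with hUdef
  have hne : (x - y) / 2 ≠ 0 := div_ne_zero (sub_ne_zero.mpr hxy) two_ne_zero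
  have hanti : antiNorm F = |(x - y) / 2| := by
    rw [antiNorm, ← Real.sqrt_sq_eq_abs]
    simp [hF]
  have hU : IsOpen U := by
    refine (isOpen_det_pos F ξ η).inter ?_
    simp only [antiNorm_add_smul]
    exact isOpen_lt (by fun_prop) (by fun_prop)
  have h0U : 0 ∈ U := by
    refine ⟨?_, ?_⟩
    · simpa [hF] using mul_pos hx hy
    · simpa [hanti] using sub_ne_zero.mpr hxy
  obtain ⟨ρ₁, ρ₂, Hρ, hρ1⟩ := exists_isModulus_antiNorm F ξ η (U := U) (fun s hs => hs.2) hr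
  have hρ1' : ρ₁ 0 * |(x - y) / 2| = (x - y) / 2 * c := by
    have h1 := abs_pos.mpr hne
    rw [hρ1, hanti, hc, div_mul_cancel₀ _ h1.ne']
    simp [hF]
  suffices H : ∃ ρ ρ₁ ρ₂, IsModulus U r ρ ρ₁ ρ₂ ∧
      (∀ s ∈ U, ρ s ^ 2 = antiNorm (F + s • Matrix.vecMulVec ξ η) ^ 2) ∧
      ρ 0 = (x - y) / 2 ∧ ρ₁ 0 = c by
    obtain ⟨ρ, ρ₁, ρ₂, Hρ, hsq, hρ0, hρ1⟩ := H
    have := energy_form_nonneg_of_rankOneConvex hh hf hsymm hW hconv hx hy ξ η hr hU h0U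
      (fun s hs => hs.1) Hρ hsq hρ0 ht hz hu hv hw ha
    have h2 := Hρ.mul_eq 0 h0U
    rw [hρ0, hρ1] at h2
    rwa [hρ1, eq_div_of_mul_eq hne ((mul_comm _ _).trans h2)] at this
  rcases hne.lt_or_gt with hlt | hgt
  -- For x < y the sign is flipped so that ρ starts at (x - y)/2.
  · refine ⟨_, _, _, Hρ.neg, fun s _ => neg_sq _, ?_, ?_⟩
    · simp only [zero_smul, add_zero, hanti, abs_of_neg hlt, neg_neg]
    · rw [abs_of_neg hlt] at hρ1'
      exact mul_left_cancel₀ hne (by linarith)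
  · refine ⟨_, _, _, Hρ, fun s _ => rfl, ?_, ?_⟩
    · simp only [zero_smul, add_zero, hanti, abs_of_pos hgt]
    · rw [abs_of_pos hgt] at hρ1'
      exact mul_left_cancel₀ hne (by linarith)

lemma conditionA_of_rankOneConvex (hh : ContDiffOn ℝ 2 h (Set.Ioi 0))
    (hf : ContDiffOn ℝ 2 f (Set.Ioi 0)) (hsymm : ∀ t : ℝ, 0 < t → h t = h (1 / t))
    (hW : ∀ F : Matrix (Fin 2) (Fin 2) ℝ, 0 < F.det → W F = volIso h f (sigma1 F) (sigma2 F))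
    (hconv : RankOneConvexGLPos W) : ConditionA h f := by
  intro t z ht hz
  simpa using quadratic_nonneg_of_rankOneConvex hh hf hsymm hW hconv ht hz zero_le_one le_rfl

lemma conditionD_of_rankOneConvex (hh : ContDiffOn ℝ 2 h (Set.Ioi 0))
    (hf : ContDiffOn ℝ 2 f (Set.Ioi 0)) (hsymm : ∀ t : ℝ, 0 < t → h t = h (1 / t))
    (hW : ∀ F : Matrix (Fin 2) (Fin 2) ℝ, 0 < F.det → W F = volIso h f (sigma1 F) (sigma2 F))
    (hconv : RankOneConvexGLPos W) : ConditionD h f := by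
  have hA := conditionA_of_rankOneConvex hh hf hsymm hW hconv
  exact conditionD_iff.mpr fun t z ht hz =>
    sqrt_add_nonneg_of_quadratic (hA t z ht hz) (hA.inv hh hsymm ht hz) fun m n hm hn =>
      quadratic_nonneg_of_rankOneConvex hh hf hsymm hW hconv ht hz hm hn

lemma conditionC_of_rankOneConvex (hh : ContDiffOn ℝ 2 h (Set.Ioi 0))
    (hf : ContDiffOn ℝ 2 f (Set.Ioi 0)) (hsymm : ∀ t : ℝ, 0 < t → h t = h (1 / t))
    (hW : ∀ F : Matrix (Fin 2) (Fin 2) ℝ, 0 < F.det → W F = volIso h f (sigma1 F) (sigma2 F))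
    (hconv : RankOneConvexGLPos W) : ConditionC h f := by
  have hA := conditionA_of_rankOneConvex hh hf hsymm hW hconv
  refine conditionC_iff.mpr fun t z ht hz ht1 =>
    sqrt_add_nonneg_of_quadratic (hA t z ht hz) (hA.inv hh hsymm ht hz) fun m n hm hn => ?_
  obtain ⟨x, y, hx, hy, rfl, rfl⟩ := exists_div_eq_mul_eq ht hz
  have hxy : x ≠ y := by rintro rfl; exact ht1 (div_self hx.ne')
  have hxy' := sub_ne_zero.mpr hxy
  obtain ⟨α, hα2⟩ : ∃ α : ℝ, α ^ 2 = m / y := ⟨_, Real.sq_sqrt (by positivity)⟩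
  obtain ⟨β, hβ2⟩ : ∃ β : ℝ, β ^ 2 = n / x := ⟨_, Real.sq_sqrt (by positivity)⟩
  -- With ξ = η it is p that moves radially (P' = r), and the form is evaluated at (m, n).
  have H := energy_form_nonneg_of_rankOneConvex_of_ne hh hf hsymm hW hconv hx hy hxy
    ![α, β] ![α, β] (r := (α ^ 2 + β ^ 2) / 2) (by simp; ring) rfl rfl rfl rfl rfl
    (a := (m / y + n / x) / 2) (c := (m / y - n / x) / 2)
    (by simp [← hα2, ← hβ2]; ring) (by simp [← hα2, ← hβ2]; ring)
  rw [hα2, hβ2] at H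
  refine H.trans_eq ?_
  generalize deriv (deriv h) (x / y) = d2
  generalize deriv h (x / y) = d1
  generalize deriv (deriv f) (x * y) = e2
  have e : x / y - 1 = (x - y) / y := by field_simp
  rw [e]
  field_simp
  ring

lemma conditionB_of_rankOneConvex (hh : ContDiffOn ℝ 2 h (Set.Ioi 0))
    (hf : ContDiffOn ℝ 2 f (Set.Ioi 0)) (hsymm : ∀ t : ℝ, 0 < t → h t = h (1 / t))
    (hW : ∀ F : Matrix (Fin 2) (Fin 2) ℝ, 0 < F.det → W F = volIso h f (sigma1 F) (sigma2 F))
    (hconv : RankOneConvexGLPos W) : ConditionB h := by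
  intro t ht
  rcases ht.eq_or_lt with rfl | ht
  · rw [deriv_one_eq_zero hh hsymm]
  have h0 : 0 < t := by linarith
  have h1 : 0 < t - 1 := by linarith
  -- Along e₁ ⊗ e₂ both moduli are stationary at s = 0, so only the multiple of v(P/ρ - ρ/P)
  -- survives.
  have H := energy_form_nonneg_of_rankOneConvex_of_ne hh hf hsymm hW hconv h0 one_pos ht.ne'
    ![1, 0] ![0, 1] (r := 1 / 2) (by norm_num) (div_one t).symm (mul_one t).symm rfl rfl rfl
    (a := 0) (c := 0) (by simp) (by simp)
  refine nonneg_of_mul_nonneg_left (H.trans_eq ?_)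
    (by positivity : 0 < 2 * t ^ 3 / ((t - 1) * (t + 1)))
  field_simp
  ring

/-- Rank-one convexity of a volumetric-isochorically split energy in the plane. -/
lemma rankOneConvexGLPos_iff (hh : ContDiffOn ℝ 2 h (Set.Ioi 0))
    (hf : ContDiffOn ℝ 2 f (Set.Ioi 0)) (hsymm : ∀ t : ℝ, 0 < t → h t = h (1 / t))
    (hW : ∀ F : Matrix (Fin 2) (Fin 2) ℝ, 0 < F.det → W F = volIso h f (sigma1 F) (sigma2 F)) :
    RankOneConvexGLPos W ↔
      ConditionA h f ∧ ConditionB h ∧ ConditionC h f ∧ ConditionD h f :=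
  ⟨fun H => ⟨conditionA_of_rankOneConvex hh hf hsymm hW H,
    conditionB_of_rankOneConvex hh hf hsymm hW H, conditionC_of_rankOneConvex hh hf hsymm hW H,
    conditionD_of_rankOneConvex hh hf hsymm hW H⟩,
  fun ⟨hA, hB, hC, hD⟩ => rankOneConvexGLPos_of_conditions hh hf hsymm hW hA hB hC hD⟩

end Necessity

end PlanarElasticity

theorem mainTheorem2
    (h f : ℝ → ℝ)
    (hh : ContDiffOn ℝ 2 h (Set.Ioi 0))
    (hf : ContDiffOn ℝ 2 f (Set.Ioi 0))
    (hsymm : ∀ t : ℝ, 0 < t → h t = h (1 / t))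
    (W : Matrix (Fin 2) (Fin 2) ℝ → ℝ)
    (hW : ∀ F : Matrix (Fin 2) (Fin 2) ℝ, 0 < F.det →
      W F = PlanarElasticity.volIso h f (PlanarElasticity.sigma1 F) (PlanarElasticity.sigma2 F)) :
    (PlanarElasticity.RankOneConvexGLPos W ↔
      PlanarElasticity.ConditionA h f ∧ PlanarElasticity.ConditionB h ∧
        PlanarElasticity.ConditionC h f ∧ PlanarElasticity.ConditionD h f) ∧
    (PlanarElasticity.ConditionA h f ↔
      PlanarElasticity.KnowlesSternbergI (PlanarElasticity.volIso h f)) ∧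
    (PlanarElasticity.ConditionB h ↔
      PlanarElasticity.KnowlesSternbergII (PlanarElasticity.volIso h f)) ∧
    (PlanarElasticity.ConditionC h f ↔
      PlanarElasticity.KnowlesSternbergIV (PlanarElasticity.volIso h f)) ∧
    (PlanarElasticity.ConditionD h f ↔
      PlanarElasticity.KnowlesSternbergV (PlanarElasticity.volIso h f)) ∧
    (PlanarElasticity.ConditionB h →
      PlanarElasticity.KnowlesSternbergIII (PlanarElasticity.volIso h f)) := by
  exact ⟨PlanarElasticity.rankOneConvexGLPos_iff hh hf hsymm hW,
    PlanarElasticity.conditionA_iff_knowlesSternbergI hh hf hsymm,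
    PlanarElasticity.conditionB_iff_knowlesSternbergII hh hf hsymm,
    PlanarElasticity.conditionC_iff_knowlesSternbergIV hh hf,
    PlanarElasticity.conditionD_iff_knowlesSternbergV hh hf,
    fun hB => hB.knowlesSternbergIII hh hf hsymm⟩
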